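/- Let $n\ge 1$ agents $a_1,\dots,a_n$ and a finite set $M=\{e_1,\dots,e_m\}$ of indivisible items be given, and let item $e_j$ have size $s_{i,j}$ with $0<s_{i,j}\le 1$ for agent $a_i$; write $s_i(S)=\sum_{e_j\in S}s_{i,j}$ for $S\subseteq M$. A $k$-partition of $S$ is a tuple $(S_1,\dots,S_k)$ of pairwise disjoint, possibly empty, sets with union $S$. Let $v_i(S)$ be the maximum integer $\tau\ge 0$ such that $\tau = 0$ or $S$ has a $\tau$-partition $(S_1,\dots,S_\tau)$ with $s_i(S_j)\ge 1$ for all $j$ (the number of unit bins that $a_i$ can cover with $S$), and let \[ \kappa_i=\max_{(X_1,\dots,X_n)}\ \min_{1\le j\le n} v_i(X_j), \] the maximum being over all $n$-partitions of $M$, be the maximin share of $a_i$. Then there exists a $\frac23$-CMMS allocation, that is, an $n$-partition $(A_1,\dots,A_n)$ of $M$ such that for every agent $a_i$ with $\kappa_i\ge 1$ the bundle $A_i$ has a $\kappa_i$-partition $(A_{i,1},\dots,A_{i,\kappa_i})$ with $s_i(A_{i,j})\ge\frac23$ for all $j$ (if $\kappa_i=0$, nothing is required of $A_i$). -/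

import Mathlib

/-- `P` is a `k`-partition of the item set `S`: the parts are pairwise disjoint and their union
is `S`. Parts may be empty. -/
def IsKPartition {m k : ℕ} (P : Fin k → Finset (Fin m)) (S : Finset (Fin m)) : Prop :=
  Finset.univ.biUnion P = S ∧ Pairwise fun j l => Disjoint (P j) (P l)

/-- A bin covering instance with `n` agents and `m` indivisible items. Every agent has bins of
capacity `1`, and `size i e` is the size of item `e` in the opinion of agent `i`. -/
structure BinCoveringInstance (n m : ℕ) where
  size : Fin n → Fin m → ℝ
  size_pos : ∀ i e, 0 < size i e
  size_le_one : ∀ i e, size i e ≤ 1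

namespace BinCoveringInstance

variable {n m : ℕ} (I : BinCoveringInstance n m)

/-- The total size `s_i(S)` of the bundle `S` for agent `i`. -/
def bundleSize (i : Fin n) (S : Finset (Fin m)) : ℝ := ∑ e ∈ S, I.size i e

/-- Agent `i` can partition `S` into `k` bundles, each of total size at least `α`.
For `k = 0` nothing is required (zero bins are always covered, even if `S` is nonempty). -/
def CanSplit (i : Fin n) (α : ℝ) (k : ℕ) (S : Finset (Fin m)) : Prop :=
  0 < k → ∃ P : Fin k → Finset (Fin m), IsKPartition P S ∧ ∀ j, α ≤ I.bundleSize i (P j)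

/-- The bin covering valuation `v_i(S)`: the maximum number of unit bins that agent `i` can cover
with the items of `S`. -/
noncomputable def value (i : Fin n) (S : Finset (Fin m)) : ℕ :=
  sSup {k : ℕ | I.CanSplit i 1 k S}

/-- The maximin share `κ_i = max_{(X_1,…,X_n)} min_j v_i(X_j)`, the maximum being over all
`n`-partitions of the set of all items. -/
noncomputable def mms (i : Fin n) : ℕ :=
  sSup {κ : ℕ | ∃ X : Fin n → Finset (Fin m),
    IsKPartition X Finset.univ ∧ κ = ⨅ j, I.value i (X j)}

/-- An allocation is an `n`-partition of the set of all items, `A i` being the bundle of agent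
`i`; it is `α`-CMMS if every agent `i` can partition `A i` into `κ_i` bundles, each of total size
at least `α`. -/
def IsCMMSAllocation (α : ℝ) (A : Fin n → Finset (Fin m)) : Prop :=
  IsKPartition A Finset.univ ∧ ∀ i, I.CanSplit i α (I.mms i) (A i)

/-- The maximum in the definition of `value` is attained. -/
theorem isGreatest_value (i : Fin n) (S : Finset (Fin m)) :
    IsGreatest {k : ℕ | I.CanSplit i 1 k S} (I.value i S) := by
  have hne : {k : ℕ | I.CanSplit i 1 k S}.Nonempty := ⟨0, fun h => absurd h (lt_irrefl 0)⟩
  have hb : BddAbove {k : ℕ | I.CanSplit i 1 k S} := by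
    refine ⟨S.card, fun k hk => ?_⟩
    rcases Nat.eq_zero_or_pos k with rfl | hpos
    · exact Nat.zero_le _
    obtain ⟨P, ⟨hU, hD⟩, hs⟩ := hk hpos
    rw [← hU, Finset.card_biUnion fun j _ l _ hjl => hD hjl]
    calc k = ∑ _j : Fin k, 1 := by simp
      _ ≤ ∑ j : Fin k, (P j).card := by
        refine Finset.sum_le_sum fun j _ => Finset.card_pos.2 ?_
        rw [Finset.nonempty_iff_ne_empty]
        intro h
        have h1 := hs j
        rw [h] at h1
        simp only [bundleSize, Finset.sum_empty] at h1
        linarith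
  exact ⟨Nat.sSup_mem hne hb, fun k hk => le_csSup hb hk⟩

/-- The maximum in the definition of `mms` is attained. -/
theorem isGreatest_mms (i : Fin n) :
    IsGreatest {κ : ℕ | ∃ X : Fin n → Finset (Fin m),
      IsKPartition X Finset.univ ∧ κ = ⨅ j, I.value i (X j)} (I.mms i) := by
  have hne : {κ : ℕ | ∃ X : Fin n → Finset (Fin m),
      IsKPartition X Finset.univ ∧ κ = ⨅ j, I.value i (X j)}.Nonempty := by
    refine ⟨_, fun j => if j = i then Finset.univ else ∅, ⟨?_, ?_⟩, rfl⟩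
    · ext e
      simp only [Finset.mem_biUnion, Finset.mem_univ, true_and, iff_true]
      exact ⟨i, by simp⟩
    · intro j l hjl
      by_cases hj : j = i
      · have hl : l ≠ i := fun h => hjl (hj.trans h.symm)
        simp [hl]
      · simp [hj]
  have hfin : {κ : ℕ | ∃ X : Fin n → Finset (Fin m),
      IsKPartition X Finset.univ ∧ κ = ⨅ j, I.value i (X j)}.Finite := by
    refine (Set.finite_range fun X : Fin n → Finset (Fin m) => ⨅ j, I.value i (X j)).subset ?_
    rintro κ ⟨X, -, rfl⟩
    exact ⟨X, rfl⟩
  exact ⟨Nat.sSup_mem hne hfin.bddAbove, fun k hk => le_csSup hfin.bddAbove hk⟩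

end BinCoveringInstance

/-!
Each agent sorts the items by size and looks at positions only; two of her items of size at least
`1 / 3` make a bin, and the other items are small. The positions are dealt into `n` columns in
snake order, and bag `j` starts with the large items of column `j`. An agent covers her `κ` bins
from this bag as soon as the small items in it make up, to within `1 / 3`, for the gaps of the
column: the sizes missing, up to level `1`, in those of the `κ` bins that are not pairs of large
items. So small items can be added to the bag one at a time until some agent covers her bins, and
the other agents, who do not cover theirs before the last item, lose no more small items than the
gaps of the column. Hence the small items that are left always pay for the gaps of the remaining
columns, provided that at the start all small items together pay for all gaps. This is where the
maximin share enters: the agent packs `n * κ` bins of level `1`, and dual weights of the packing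
linear program turn this into the required inequality. Finally, positions become items by letting
their owners pick in turn.
-/

/-- The items of `S`, of sizes `s`, cover `k` bins up to level `θ`. The bins are given by a
labelling of the items; items with a label `≥ k` are not used. -/
def Covers {α : Type*} (θ : ℝ) (s : α → ℝ) (S : Finset α) (k : ℕ) : Prop :=
  ∃ f : α → ℕ, ∀ j < k, θ ≤ ∑ x ∈ S with f x = j, s x

theorem exists_subset_sum_mem_Icc {α : Type*} [DecidableEq α] {s : α → ℝ} {b δ : ℝ}
    {H W : Finset α} (hHW : H ⊆ W) (hH : ∑ x ∈ H, s x ≤ b) (hW : b - δ ≤ ∑ x ∈ W, s x)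
    (hδ : ∀ x ∈ W \ H, s x ≤ δ) :
    ∃ P, H ⊆ P ∧ P ⊆ W ∧ ∑ x ∈ P, s x ∈ Set.Icc (b - δ) b := by
  obtain ⟨P, hPW, ⟨hHP, hP⟩, hmin⟩ := exists_minimal_le_of_wellFoundedLT
    (fun P => H ⊆ P ∧ b - δ ≤ ∑ x ∈ P, s x) W ⟨hHW, hW⟩
  refine ⟨P, hHP, hPW, hP, ?_⟩
  rcases hHP.eq_or_ssubset with rfl | hlt
  · exact hH
  obtain ⟨x, hxP, hxH⟩ := Finset.exists_of_ssubset hlt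
  have herase : ∑ y ∈ P.erase x, s y < b - δ := by
    by_contra! hge
    exact Finset.notMem_erase x P (hmin ⟨Finset.subset_erase.2 ⟨hHP, hxH⟩, hge⟩
      (Finset.erase_subset x P) hxP)
  have hx := hδ x (Finset.mem_sdiff.2 ⟨hPW hxP, hxH⟩)
  linarith [Finset.sum_erase_add P s hxP]

namespace Covers

variable {α : Type*} {θ : ℝ} {s : α → ℝ} {S T : Finset α} {k l : ℕ}

theorem zero : Covers θ s S 0 :=
  ⟨fun _ => 0, fun j hj => absurd hj j.not_lt_zero⟩

theorem one (h : θ ≤ ∑ x ∈ S, s x) : Covers θ s S 1 :=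
  ⟨fun _ => 0, fun j hj => by simpa [Nat.lt_one_iff.1 hj] using h⟩

theorem mono (hs : ∀ x, 0 ≤ s x) (hST : S ⊆ T) (hlk : l ≤ k) (h : Covers θ s S k) :
    Covers θ s T l := by
  obtain ⟨f, hf⟩ := h
  exact ⟨f, fun j hj => (hf j (hj.trans_le hlk)).trans
    (Finset.sum_le_sum_of_subset_of_nonneg (Finset.filter_subset_filter _ hST) fun x _ _ => hs x)⟩

theorem comap {β : Type*} [DecidableEq α] {t : β → ℝ} {T : Finset β} (ht : ∀ y, 0 ≤ t y)
    (e : β → α) (hST : ∀ x ∈ S, s x ≤ ∑ y ∈ T with e y = x, t y) (h : Covers θ s S k) :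
    Covers θ t T k := by
  obtain ⟨f, hf⟩ := h
  refine ⟨f ∘ e, fun j hj => (hf j hj).trans ?_⟩
  calc ∑ x ∈ S with f x = j, s x
      ≤ ∑ x ∈ S with f x = j, ∑ y ∈ T with e y = x, t y :=
        Finset.sum_le_sum fun x hx => hST x (Finset.mem_filter.1 hx).1
    _ = ∑ x ∈ S with f x = j, ∑ y ∈ T.filter (fun y => f (e y) = j) with e y = x, t y := by
        refine Finset.sum_congr rfl fun x hx => Finset.sum_congr ?_ fun _ _ => rfl
        rw [Finset.filter_filter]
        refine Finset.filter_congr fun y _ => ⟨?_, And.right⟩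
        rintro rfl
        exact ⟨(Finset.mem_filter.1 hx).2, rfl⟩
    _ ≤ ∑ y ∈ T with f (e y) = j, t y :=
        Finset.sum_fiberwise_le_sum_of_sum_fiber_nonneg fun _ _ =>
          Finset.sum_nonneg fun y _ => ht y

theorem union [DecidableEq α] (hs : ∀ x, 0 ≤ s x) (hST : Disjoint S T) (hS : Covers θ s S k)
    (hT : Covers θ s T l) : Covers θ s (S ∪ T) (k + l) := by
  obtain ⟨f, hf⟩ := hS
  obtain ⟨g, hg⟩ := hT
  refine ⟨fun x => if x ∈ S then f x else k + g x, fun j hj => ?_⟩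
  have hle : ∀ {R : Finset α}, R ⊆ {x ∈ S ∪ T | (if x ∈ S then f x else k + g x) = j} →
      ∑ x ∈ R, s x ≤ ∑ x ∈ S ∪ T with (if x ∈ S then f x else k + g x) = j, s x :=
    fun hR => Finset.sum_le_sum_of_subset_of_nonneg hR fun x _ _ => hs x
  rcases lt_or_ge j k with hjk | hjk
  · refine (hf j hjk).trans (hle fun x hx => ?_)
    obtain ⟨hxS, hx⟩ := Finset.mem_filter.1 hx
    simp [hxS, hx]
  · refine (hg (j - k) (by omega)).trans (hle fun x hx => ?_)
    obtain ⟨hxT, hx⟩ := Finset.mem_filter.1 hx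
    simp only [Finset.mem_filter, Finset.mem_union, hxT, or_true, true_and,
      Finset.disjoint_right.1 hST hxT, if_false, hx]
    omega

theorem of_two_mul_le_card (hs : ∀ x, 0 ≤ s x) (hS : ∀ x ∈ S, θ / 2 ≤ s x)
    (hk : 2 * k ≤ S.card) : Covers θ s S k := by
  classical
  induction k generalizing S with
  | zero => exact zero
  | succ k ih =>
    obtain ⟨U, hUS, hU⟩ := Finset.exists_subset_card_eq (show 2 ≤ S.card by omega)
    have hrest : Covers θ s (S \ U) k :=
      ih (fun x hx => hS x (Finset.sdiff_subset hx)) (by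
        rw [Finset.card_sdiff_of_subset hUS]
        omega)
    have hpair : Covers θ s U 1 := one <| by
      have := Finset.card_nsmul_le_sum U s (θ / 2) fun x hx => hS x (hUS hx)
      rw [hU, nsmul_eq_mul, Nat.cast_two] at this
      linarith
    simpa only [Finset.sdiff_union_of_subset hUS] using
      hrest.union hs Finset.sdiff_disjoint hpair

-- The bins are closed one by one, starting with one of the items larger than `δ`, if there are
-- any, and adding items of size at most `δ`, so that no bin exceeds level `1`.
theorem of_card_filter_lt_le {δ : ℝ} (hs : ∀ x, 0 ≤ s x) (hs1 : ∀ x ∈ S, s x ≤ 1)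
    (hcard : (S.filter (δ < s ·)).card ≤ k) (hsum : (k : ℝ) ≤ ∑ x ∈ S, s x + δ) :
    Covers (1 - δ) s S k := by
  classical
  induction k generalizing S with
  | zero => exact zero
  | succ k ih =>
    push_cast at hsum
    set L := S.filter (δ < s ·) with hL
    have hLS : L ⊆ S := Finset.filter_subset _ _
    obtain ⟨H, hHL, hH⟩ := Finset.exists_subset_card_eq (min_le_right 1 L.card)
    have hcard' : (L \ H).card ≤ k := by
      rw [Finset.card_sdiff_of_subset hHL]
      omega
    have hsumH : ∑ x ∈ H, s x ≤ 1 := by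
      refine (Finset.sum_le_card_nsmul H s 1 fun x hx => hs1 x (hLS (hHL hx))).trans ?_
      simp [hH]
    have hsumL : ∑ x ∈ L \ H, s x ≤ k := by
      refine (Finset.sum_le_card_nsmul _ s 1 fun x hx =>
        hs1 x (hLS (Finset.sdiff_subset hx))).trans ?_
      simpa using hcard'
    have hsdiff : L \ H ⊆ S := Finset.sdiff_subset.trans hLS
    obtain ⟨P, hHP, hPW, hP, hP1⟩ := exists_subset_sum_mem_Icc (δ := δ) (W := S \ (L \ H))
      (fun x hx => by simp [hx, hLS (hHL hx)]) hsumH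
      (by linarith [Finset.sum_sdiff (f := s) hsdiff])
      (fun x hx => by
        simp only [hL, Finset.mem_sdiff, Finset.mem_filter] at hx
        by_contra! hlt
        exact hx.1.2 ⟨⟨hx.1.1, hlt⟩, hx.2⟩)
    have hPS : P ⊆ S := hPW.trans Finset.sdiff_subset
    have hrest : Covers (1 - δ) s (S \ P) k := by
      refine ih (fun x hx => hs1 x (Finset.sdiff_subset hx))
        ((Finset.card_le_card fun x hx => ?_).trans hcard')
        (by linarith [Finset.sum_sdiff (f := s) hPS])
      simp only [Finset.mem_filter, Finset.mem_sdiff, hL] at hx ⊢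
      exact ⟨⟨hx.1.1, hx.2⟩, fun hxH => hx.1.2 (hHP hxH)⟩
    simpa only [Finset.sdiff_union_of_subset hPS] using
      hrest.union hs Finset.sdiff_disjoint (one hP)

end Covers

section Snake

/-- The column of the item at position `x` if items are dealt into the columns `0, …, n - 1` in
boustrophedon order `0, …, n - 1, n - 1, …, 0, 0, …`. -/
def snakeColumn (n x : ℕ) : ℕ := min (x % (2 * n)) (2 * n - 1 - x % (2 * n))

variable {n j : ℕ}

theorem snakeColumn_lt (hn : 0 < n) (x : ℕ) : snakeColumn n x < n := by
  unfold snakeColumn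
  omega

theorem snakeColumn_of_lt {x : ℕ} (hx : x < n) : snakeColumn n x = x := by
  rw [snakeColumn, Nat.mod_eq_of_lt (by omega)]
  omega

theorem snakeColumn_mul_add (k x : ℕ) : snakeColumn n (2 * n * k + x) = snakeColumn n x := by
  simp only [snakeColumn, Nat.mul_add_mod]

theorem snakeColumn_eq_of_add_add_one_eq {k x y : ℕ} (h : x + y + 1 = 2 * n * k) :
    snakeColumn n x = snakeColumn n y := by
  have hn : 0 < 2 * n := Nat.pos_of_ne_zero fun h0 => by simp [h0] at h
  have hmod : x % (2 * n) + y % (2 * n) + 1 ≡ x + y + 1 [MOD 2 * n] :=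
    ((Nat.mod_modEq x _).add (Nat.mod_modEq y _)).add_right 1
  obtain ⟨q, hq⟩ := (hmod.dvd_iff dvd_rfl).2 ⟨k, h⟩
  have hx := Nat.mod_lt x hn
  have hy := Nat.mod_lt y hn
  have hq1 : q = 1 := by
    have hq2 : 2 * n * q < 2 * n * 2 := by omega
    have := Nat.lt_of_mul_lt_mul_left hq2
    rcases Nat.eq_zero_or_pos q with rfl | _ <;> omega
  rw [hq1] at hq
  unfold snakeColumn
  omega

theorem count_add_count_of_reflect {p : ℕ → Prop} [DecidablePred p] {a b : ℕ}
    (hp : ∀ x y, x + y + 1 = a + b → (p x ↔ p y)) :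
    Nat.count p a + Nat.count p b = Nat.count p (a + b) := by
  rw [Nat.count_add, Nat.count_eq_card_filter_range p b, Nat.count_eq_card_filter_range _ b,
    Finset.card_filter, Finset.card_filter, ← Finset.sum_range_reflect]
  congr 1
  refine Finset.sum_congr rfl fun x hx => if_congr (hp _ _ ?_) rfl rfl
  have := Finset.mem_range.1 hx
  omega

theorem count_snakeColumn_mul (hj : j < n) (k : ℕ) :
    Nat.count (snakeColumn n · = j) (2 * n * k) = 2 * k := by
  have hrow : Nat.count (snakeColumn n · = j) n = 1 := by
    rw [Nat.count_eq_card_filter_range, Finset.card_eq_one]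
    refine ⟨j, Finset.ext fun x => ?_⟩
    simp only [Finset.mem_filter, Finset.mem_range, Finset.mem_singleton]
    exact ⟨fun hx => snakeColumn_of_lt hx.1 ▸ hx.2, fun hx => by simp [hx, hj, snakeColumn_of_lt]⟩
  have hperiod : Nat.count (snakeColumn n · = j) (2 * n) = 2 := by
    rw [two_mul, ← count_add_count_of_reflect, hrow]
    intro x y hxy
    rw [snakeColumn_eq_of_add_add_one_eq (k := 1) (hxy.trans (by ring))]
  induction k with
  | zero => simp
  | succ k ih =>
    rw [Nat.mul_succ, Nat.count_add, ih]
    simp only [snakeColumn_mul_add, hperiod]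
    omega

theorem count_snakeColumn_add_count {k a b : ℕ} (hj : j < n) (hab : a + b = 2 * n * k) :
    Nat.count (snakeColumn n · = j) a + Nat.count (snakeColumn n · = j) b = 2 * k := by
  rw [count_add_count_of_reflect, hab, count_snakeColumn_mul hj]
  intro x y hxy
  rw [snakeColumn_eq_of_add_add_one_eq (hxy.trans hab)]

end Snake

section UnitBins

variable {α : Type*}

/-- Linear programming duality: these are the dual weights of the items, `p` singling out the
large ones. -/
theorem two_mul_one_sub_le_sum_ite {s : α → ℝ} {Q : Finset α} {θ : ℝ} (p : α → Prop)
    [DecidablePred p] (hs : ∀ x, 0 ≤ s x) (hθ : 1 / 2 ≤ θ) (hθ1 : θ ≤ 1)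
    (hQ : 1 ≤ ∑ x ∈ Q, s x) :
    2 * (1 - θ) ≤ ∑ x ∈ Q, if p x then (1 - θ) + (s x - θ)⁺ else s x := by
  set d := (Q.filter p).card with hd
  rcases lt_or_ge d 2 with hd2 | hd2
  · have hweight : ∑ x ∈ Q, s x + d * (1 - 2 * θ) ≤
        ∑ x ∈ Q, if p x then (1 - θ) + (s x - θ)⁺ else s x := by
      rw [← nsmul_eq_mul, hd, ← Finset.sum_const, Finset.sum_filter, ← Finset.sum_add_distrib]
      refine Finset.sum_le_sum fun x _ => ?_
      split_ifs
      · linarith [le_posPart (s x - θ)]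
      · exact (add_zero _).le
    have : (d : ℝ) ≤ 1 := by exact_mod_cast Nat.lt_succ_iff.1 hd2
    nlinarith
  · have hweight : d * (1 - θ) ≤ ∑ x ∈ Q, if p x then (1 - θ) + (s x - θ)⁺ else s x := by
      rw [← nsmul_eq_mul, hd, ← Finset.sum_const, Finset.sum_filter]
      refine Finset.sum_le_sum fun x _ => ?_
      split_ifs
      · exact le_add_of_nonneg_right (posPart_nonneg _)
      · exact hs x
    have : (2 : ℝ) ≤ d := by exact_mod_cast hd2
    nlinarith

theorem card_mul_le_sum_of_pairwise_disjoint {ι : Type*} [Fintype ι] {w : α → ℝ} {b : ℝ}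
    {U : Finset α} {Q : ι → Finset α} (hw : ∀ x, 0 ≤ w x)
    (hQ : Pairwise fun i j => Disjoint (Q i) (Q j)) (hQU : ∀ i, Q i ⊆ U)
    (hb : ∀ i, b ≤ ∑ x ∈ Q i, w x) : Fintype.card ι * b ≤ ∑ x ∈ U, w x := by
  classical
  calc Fintype.card ι * b ≤ ∑ i, ∑ x ∈ Q i, w x := by
        simpa using Finset.card_nsmul_le_sum Finset.univ _ b fun i _ => hb i
    _ = ∑ x ∈ Finset.univ.biUnion Q, w x :=
        (Finset.sum_biUnion fun i _ j _ hij => hQ hij).symm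
    _ ≤ ∑ x ∈ U, w x := Finset.sum_le_sum_of_subset_of_nonneg
        (Finset.biUnion_subset.2 fun i _ => hQU i) fun x _ _ => hw x

theorem sum_ite_lt_le {f g : ℕ → ℝ} (hf : ∀ x, 0 ≤ f x) (c : ℕ) (U : Finset ℕ) :
    ∑ x ∈ U, (if x < c then f x else g x) ≤
      ∑ x ∈ Finset.range c, f x + ∑ x ∈ U with c ≤ x, g x := by
  rw [Finset.sum_ite]
  simp only [not_lt]
  gcongr with x
  · exact fun _ _ _ => hf _
  · intro x hx
    simpa using (Finset.mem_filter.1 hx).2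

end UnitBins

section Reserve

/-- The number of items of size at least `1 / 3`, called large, among the `2 * N` largest ones. More
are never needed to cover `N` bins, since two of them fill a bin up to level `2 / 3`. -/
noncomputable def largeCount (s : ℕ → ℝ) (N : ℕ) : ℕ := Nat.count (1 / 3 ≤ s ·) (2 * N)

/-- The number of bins out of `N` that receive at most one large item: if there are at least `N`
large items, then the other `N - headCount s N` bins can be covered by pairs of large items. -/
noncomputable def headCount (s : ℕ → ℝ) (N : ℕ) : ℕ := min N (2 * N - largeCount s N)

/-- The missing size of a bin started with the `x`-th item, or with no item at all if the `x`-th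
item is not large. -/
noncomputable def gap (s : ℕ → ℝ) (N x : ℕ) : ℝ := 1 - if x < largeCount s N then s x else 0

variable {s : ℕ → ℝ} {N x : ℕ}

theorem largeCount_le : largeCount s N ≤ 2 * N := Nat.count_le _

theorem lt_largeCount_iff (hs : Antitone s) : x < largeCount s N ↔ x < 2 * N ∧ 1 / 3 ≤ s x := by
  refine ⟨fun hx => ?_, fun ⟨hxN, hx⟩ => ?_⟩
  · obtain ⟨y, hy⟩ := Nat.exists_eq_add_of_le (hx.le.trans largeCount_le)
    by_contra! hlt
    have hx' : s x < 1 / 3 := hlt (hx.trans_le largeCount_le)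
    have : largeCount s N ≤ x := by
      rw [largeCount, hy, Nat.count_add, (Nat.count_iff_forall_not (n := y)).2, add_zero]
      · exact Nat.count_le _
      · exact fun z _ => not_le.2 ((hs (Nat.le_add_right x z)).trans_lt hx')
    omega
  · calc x < Nat.count (1 / 3 ≤ s ·) (x + 1) := by
          rw [(Nat.count_iff_forall (n := x + 1)).2]
          · exact x.lt_succ_self
          · exact fun y hy => hx.trans (hs (Nat.lt_succ_iff.1 hy))
      _ ≤ largeCount s N := Nat.count_monotone _ hxN

theorem lt_third_of_largeCount_le (hs : Antitone s) (hpos : 0 < headCount s N)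
    (hx : largeCount s N ≤ x) : s x < 1 / 3 := by
  have hN : largeCount s N < 2 * N := by
    unfold headCount at hpos
    omega
  by_contra! hge
  exact lt_irrefl _ ((lt_largeCount_iff hs).2 ⟨hN, hge.trans (hs hx)⟩)

theorem gap_nonneg (hs1 : ∀ x, s x ≤ 1) : 0 ≤ gap s N x := by
  unfold gap
  split_ifs <;> linarith [hs1 x]

theorem sum_gap_le_of_largeCount_le {σ : ℝ} (h : largeCount s N ≤ N)
    (htotal : N ≤ ∑ x ∈ Finset.range (largeCount s N), s x + σ) :
    ∑ x ∈ Finset.range (headCount s N), gap s N x ≤ σ := by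
  have hhead : headCount s N = N := by
    unfold headCount
    omega
  have hlarge : (Finset.range N).filter (· < largeCount s N) = Finset.range (largeCount s N) := by
    ext x
    simp only [Finset.mem_filter, Finset.mem_range]
    omega
  simp only [hhead, gap, Finset.sum_sub_distrib, ← Finset.sum_filter, hlarge, Finset.sum_const,
    Finset.card_range, nsmul_eq_mul, mul_one]
  linarith

theorem sum_gap_of_le_largeCount (h : N ≤ largeCount s N) :
    ∑ x ∈ Finset.range (headCount s N), gap s N x =
      headCount s N - ∑ x ∈ Finset.range (headCount s N), s x := by
  have hlarge : ∀ x ∈ Finset.range (headCount s N), gap s N x = 1 - s x := fun x hx => by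
    have hxh := Finset.mem_range.1 hx
    rw [gap, if_pos]
    unfold headCount at hxh
    omega
  simp [Finset.sum_congr rfl hlarge]

theorem headCount_add_largeCount (h : N ≤ largeCount s N) :
    headCount s N + largeCount s N = 2 * N := by
  have := largeCount_le (s := s) (N := N)
  unfold headCount
  omega

theorem sum_gap_le_of_dual_le {σ θ : ℝ} (hN : N ≤ largeCount s N)
    (hge : ∀ x < headCount s N, θ ≤ s x) (hle : ∀ x, headCount s N ≤ x → s x ≤ θ)
    (hdual : N * (2 * (1 - θ)) ≤
      ∑ x ∈ Finset.range (largeCount s N), ((1 - θ) + (s x - θ)⁺) + σ) :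
    ∑ x ∈ Finset.range (headCount s N), gap s N x ≤ σ := by
  have hcount : (headCount s N + largeCount s N : ℝ) = 2 * N := by
    exact_mod_cast headCount_add_largeCount hN
  have hhead : headCount s N ≤ largeCount s N := (min_le_left _ _).trans hN
  have hexcess : ∑ x ∈ Finset.range (largeCount s N), (s x - θ)⁺ =
      ∑ x ∈ Finset.range (headCount s N), s x - headCount s N * θ := by
    rw [← Finset.sum_range_add_sum_Ico _ hhead, Finset.sum_congr rfl fun x hx =>
      posPart_of_nonneg (sub_nonneg.2 (hge x (Finset.mem_range.1 hx))),
      Finset.sum_eq_zero fun x hx =>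
      posPart_of_nonpos (sub_nonpos.2 (hle x (Finset.mem_Ico.1 hx).1))]
    simp
  rw [Finset.sum_add_distrib, hexcess] at hdual
  simp only [Finset.sum_const, Finset.card_range, nsmul_eq_mul] at hdual
  rw [sum_gap_of_le_largeCount hN]
  linear_combination hdual + (1 - θ) * hcount

theorem sum_gap_le_of_forall_le_half {σ : ℝ} (hN : N ≤ largeCount s N)
    (hle : ∀ x, headCount s N ≤ x → s x ≤ 1 / 2)
    (htotal : N ≤ ∑ x ∈ Finset.range (largeCount s N), s x + σ) :
    ∑ x ∈ Finset.range (headCount s N), gap s N x ≤ σ := by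
  have hcount : (headCount s N + largeCount s N : ℝ) = 2 * N := by
    exact_mod_cast headCount_add_largeCount hN
  have hhead : headCount s N ≤ largeCount s N := (min_le_left _ _).trans hN
  have hpairs : ∑ x ∈ Finset.Ico (headCount s N) (largeCount s N), s x ≤
      (largeCount s N - headCount s N) * (1 / 2 : ℝ) := by
    rw [← Nat.cast_sub hhead, ← Nat.card_Ico, ← nsmul_eq_mul]
    exact Finset.sum_le_card_nsmul _ _ _ fun x hx => hle x (Finset.mem_Ico.1 hx).1
  rw [sum_gap_of_le_largeCount hN]
  rw [← Finset.sum_range_add_sum_Ico s hhead] at htotal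
  linarith

theorem sum_gap_le_of_bins (hs : Antitone s) (h01 : ∀ x, s x ∈ Set.Icc (0 : ℝ) 1) {ι : Type*}
    [Fintype ι] {U : Finset ℕ} {Q : ι → Finset ℕ}
    (hQ : Pairwise fun i j => Disjoint (Q i) (Q j)) (hQU : ∀ i, Q i ⊆ U)
    (hQ1 : ∀ i, 1 ≤ ∑ x ∈ Q i, s x) :
    ∑ x ∈ Finset.range (headCount s (Fintype.card ι)), gap s (Fintype.card ι) x ≤
      ∑ x ∈ U with largeCount s (Fintype.card ι) ≤ x, s x := by
  set N := Fintype.card ι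
  have hs0 : ∀ x, 0 ≤ s x := fun x => (h01 x).1
  have htotal : (N : ℝ) ≤ ∑ x ∈ Finset.range (largeCount s N), s x +
      ∑ x ∈ U with largeCount s N ≤ x, s x := by
    have := sum_ite_lt_le (g := s) hs0 (largeCount s N) U
    simp only [ite_self] at this
    exact (mul_one (N : ℝ)).symm.trans_le
      ((card_mul_le_sum_of_pairwise_disjoint hs0 hQ hQU hQ1).trans this)
  rcases le_total (largeCount s N) N with hle | hge
  · exact sum_gap_le_of_largeCount_le hle htotal
  set θ := s (headCount s N - 1)
  have hhead : ∀ x < headCount s N, θ ≤ s x := fun x hx => hs (Nat.le_sub_one_of_lt hx)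
  have htail : ∀ x, headCount s N ≤ x → s x ≤ θ := fun x hx => hs ((Nat.sub_le _ _).trans hx)
  rcases le_total θ (1 / 2) with hhalf | hhalf
  · exact sum_gap_le_of_forall_le_half hge (fun x hx => (htail x hx).trans hhalf) htotal
  have hθ1 : θ ≤ 1 := (h01 _).2
  have hweight : ∀ x, 0 ≤ (1 - θ) + (s x - θ)⁺ := fun x =>
    add_nonneg (sub_nonneg.2 hθ1) (posPart_nonneg _)
  refine sum_gap_le_of_dual_le hge hhead htail
    (le_trans ?_ (sum_ite_lt_le hweight (largeCount s N) U))
  refine card_mul_le_sum_of_pairwise_disjoint (fun x => ?_) hQ hQU fun i =>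
    two_mul_one_sub_le_sum_ite _ hs0 hhalf hθ1 (hQ1 i)
  split_ifs
  exacts [hweight x, hs0 x]

end Reserve

section Columns

/-- The total gap of the bins started with the items of column `j`, for an agent who needs `κ` bins
from each of `n` columns. -/
noncomputable def columnGap (s : ℕ → ℝ) (n κ j : ℕ) : ℝ :=
  ∑ x ∈ Finset.range (headCount s (n * κ)) with snakeColumn n x = j, gap s (n * κ) x

variable {s : ℕ → ℝ} {n κ j : ℕ}

theorem columnGap_nonneg (hs1 : ∀ x, s x ≤ 1) : 0 ≤ columnGap s n κ j :=
  Finset.sum_nonneg fun _ _ => gap_nonneg hs1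

theorem sum_columnGap (hn : 0 < n) :
    ∑ j ∈ Finset.range n, columnGap s n κ j =
      ∑ x ∈ Finset.range (headCount s (n * κ)), gap s (n * κ) x :=
  Finset.sum_fiberwise_of_maps_to (fun x _ => Finset.mem_range.2 (snakeColumn_lt hn x)) _

theorem columnGap_eq :
    columnGap s n κ j = Nat.count (snakeColumn n · = j) (headCount s (n * κ)) -
      ∑ x ∈ Finset.range (headCount s (n * κ)) with
        snakeColumn n x = j ∧ x < largeCount s (n * κ), s x := by
  simp only [columnGap, gap, Finset.sum_sub_distrib, ← Finset.sum_filter, Finset.filter_filter,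
    Finset.sum_const, nsmul_eq_mul, mul_one, Nat.count_eq_card_filter_range]

theorem two_mul_le_count_headCount_add_max (hj : j < n) :
    2 * κ ≤ Nat.count (snakeColumn n · = j) (headCount s (n * κ)) +
      max (Nat.count (snakeColumn n · = j) (headCount s (n * κ)))
        (Nat.count (snakeColumn n · = j) (largeCount s (n * κ))) := by
  have hmul : 2 * n * κ = 2 * (n * κ) := mul_assoc ..
  rcases le_total (n * κ) (largeCount s (n * κ)) with hle | hle
  · rw [← count_snakeColumn_add_count hj ((headCount_add_largeCount hle).trans hmul.symm)]
    omega
  · have hhead : headCount s (n * κ) = n * κ := by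
      unfold headCount
      omega
    rw [hhead, ← count_snakeColumn_add_count hj (show n * κ + n * κ = 2 * n * κ by omega)]
    omega

theorem covers_heads {Z : Finset ℕ} (hs : Antitone s) (h01 : ∀ x, s x ∈ Set.Icc (0 : ℝ) 1)
    (hZ : ∀ x ∈ Z, largeCount s (n * κ) ≤ x) (hgap : columnGap s n κ j ≤ ∑ x ∈ Z, s x + 1 / 3) :
    Covers (2 / 3) s ({x ∈ Finset.range (headCount s (n * κ)) |
        snakeColumn n x = j ∧ x < largeCount s (n * κ)} ∪ Z)
      (Nat.count (snakeColumn n · = j) (headCount s (n * κ))) := by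
  set H := {x ∈ Finset.range (headCount s (n * κ)) |
    snakeColumn n x = j ∧ x < largeCount s (n * κ)} with hH
  rcases Nat.eq_zero_or_pos (headCount s (n * κ)) with hzero | hpos
  · rw [hzero, Nat.count_zero]
    exact Covers.zero
  have hdisj : Disjoint H Z := Finset.disjoint_left.2 fun x hx hxZ => by
    rw [hH, Finset.mem_filter] at hx
    exact (hZ x hxZ).not_gt hx.2.2
  rw [show (2 / 3 : ℝ) = 1 - 1 / 3 by norm_num]
  refine Covers.of_card_filter_lt_le (fun x => (h01 x).1) (fun x _ => (h01 x).2) ?_ ?_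
  · rw [Nat.count_eq_card_filter_range]
    refine Finset.card_le_card fun x hx => ?_
    obtain ⟨hx, hlarge⟩ := Finset.mem_filter.1 hx
    rcases Finset.mem_union.1 hx with hxH | hxZ
    · rw [hH, Finset.mem_filter] at hxH
      exact Finset.mem_filter.2 ⟨hxH.1, hxH.2.1⟩
    · exact absurd (lt_third_of_largeCount_le hs hpos (hZ x hxZ)) hlarge.not_gt
  · rw [columnGap_eq, ← hH] at hgap
    rw [Finset.sum_union hdisj]
    linarith

theorem count_le_count_add_card_filter_Ico (p : ℕ → Prop) [DecidablePred p] (a b : ℕ) :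
    Nat.count p b ≤ Nat.count p a + ((Finset.Ico a b).filter p).card := by
  rw [Nat.count_eq_card_filter_range, Nat.count_eq_card_filter_range]
  refine (Finset.card_le_card fun x hx => ?_).trans (Finset.card_union_le _ _)
  simp only [Finset.mem_union, Finset.mem_filter, Finset.mem_range, Finset.mem_Ico] at hx ⊢
  exact (lt_or_ge x a).imp (fun hxa => ⟨hxa, hx.2⟩) fun hax => ⟨⟨hax, hx.1⟩, hx.2⟩

theorem covers_of_columnGap_le {F : Finset ℕ} (hs : Antitone s)
    (h01 : ∀ x, s x ∈ Set.Icc (0 : ℝ) 1) (hj : j < n)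
    (hF : ∀ x < largeCount s (n * κ), snakeColumn n x = j → x ∈ F)
    (hgap : columnGap s n κ j ≤ ∑ x ∈ F with largeCount s (n * κ) ≤ x, s x + 1 / 3) :
    Covers (2 / 3) s F κ := by
  have hs0 : ∀ x, 0 ≤ s x := fun x => (h01 x).1
  have hcount := two_mul_le_count_headCount_add_max (s := s) (κ := κ) hj
  have hheads := covers_heads hs h01 (fun x hx => (Finset.mem_filter.1 hx).2) hgap
  set c := largeCount s (n * κ)
  set h := headCount s (n * κ)
  have hpairs : Covers (2 / 3) s ((Finset.Ico h c).filter (snakeColumn n · = j))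
      (κ - Nat.count (snakeColumn n · = j) h) := by
    refine Covers.of_two_mul_le_card hs0 (fun x hx => ?_) ?_
    · have hxc := (Finset.mem_Ico.1 (Finset.mem_filter.1 hx).1).2
      linarith [((lt_largeCount_iff hs).1 hxc).2]
    · have := count_le_count_add_card_filter_Ico (snakeColumn n · = j) h c
      omega
  refine (hpairs.union hs0 ?_ hheads).mono hs0 ?_ (Nat.sub_le_iff_le_add.1 le_rfl)
  · rw [Finset.disjoint_left]
    intro x hx
    simp only [Finset.mem_union, Finset.mem_filter, Finset.mem_range, Finset.mem_Ico] at hx ⊢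
    omega
  · intro x hx
    simp only [Finset.mem_union, Finset.mem_filter, Finset.mem_range, Finset.mem_Ico] at hx
    rcases hx with ⟨hx, hxj⟩ | ⟨-, hxj, hxc⟩ | ⟨hxF, -⟩
    exacts [hF x hx.2 hxj, hF x hxc hxj, hxF]

theorem sum_insert_le_columnGap {F : Finset ℕ} {p : ℕ} (hs : Antitone s)
    (h01 : ∀ x, s x ∈ Set.Icc (0 : ℝ) 1) (hj : j < n)
    (hF : ∀ x < largeCount s (n * κ), snakeColumn n x = j → x ∈ F)
    (hnot : ¬ Covers (2 / 3) s F κ) (hp : largeCount s (n * κ) ≤ p) :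
    ∑ x ∈ insert p F with largeCount s (n * κ) ≤ x, s x ≤ columnGap s n κ j := by
  have hs0 : ∀ x, 0 ≤ s x := fun x => (h01 x).1
  have hlt : ∑ x ∈ F with largeCount s (n * κ) ≤ x, s x + 1 / 3 < columnGap s n κ j := by
    by_contra! hge
    exact hnot (covers_of_columnGap_le hs h01 hj hF hge)
  have hpos : 0 < headCount s (n * κ) := by
    by_contra! hzero
    have hgap : columnGap s n κ j = 0 := by simp [columnGap, Nat.le_zero.1 hzero]
    have := Finset.sum_nonneg fun x (_ : x ∈ F.filter (largeCount s (n * κ) ≤ ·)) => hs0 x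
    linarith
  have hinsert : ∑ x ∈ insert p F with largeCount s (n * κ) ≤ x, s x ≤
      s p + ∑ x ∈ F with largeCount s (n * κ) ≤ x, s x := by
    rw [Finset.filter_insert, if_pos hp]
    by_cases hpF : p ∈ F.filter (largeCount s (n * κ) ≤ ·)
    · rw [Finset.insert_eq_of_mem hpF]
      exact le_add_of_nonneg_left (hs0 p)
    · exact (Finset.sum_insert hpF).le
  linarith [lt_third_of_largeCount_le hs hpos hp]

end Columns

section BagFilling

variable {ι : Type*} {s : ι → ℕ → ℝ} {n : ℕ} {κ : ι → ℕ}

/-- The bag receives column `j` and then small items, one by one in the order of their positions,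
until some agent in `A` covers `κ i` bins. -/
theorem exists_bag (hs : ∀ i, Antitone (s i)) (h01 : ∀ i x, s i x ∈ Set.Icc (0 : ℝ) 1)
    {A : Finset ι} (hA : A.Nonempty) {U : Finset ℕ} {j : ℕ} (hj : j < n)
    (hU : ∀ i ∈ A, ∀ x < largeCount (s i) (n * κ i), snakeColumn n x = j → x ∈ U)
    (hgap : ∀ i ∈ A, columnGap (s i) n (κ i) j ≤
      ∑ x ∈ U with largeCount (s i) (n * κ i) ≤ x, s i x) :
    ∃ F ⊆ U, (∃ i ∈ A, Covers (2 / 3) (s i) F (κ i)) ∧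
      (∀ i ∈ A, ∀ x ∈ F, x < largeCount (s i) (n * κ i) → snakeColumn n x = j) ∧
      ∀ i ∈ A, ∑ x ∈ F with largeCount (s i) (n * κ i) ≤ x, s i x ≤ columnGap (s i) n (κ i) j := by
  classical
  set c : ι → ℕ := fun i => largeCount (s i) (n * κ i)
  obtain ⟨i₀, hi₀, hmax⟩ := A.exists_max_image c hA
  set V := U.filter fun x => snakeColumn n x = j ∨ c i₀ ≤ x
  have hVcol : ∀ i ∈ A, ∀ x ∈ V, x < c i → snakeColumn n x = j := fun i hi x hx hxc =>
    (Finset.mem_filter.1 hx).2.resolve_right (hxc.trans_le (hmax i hi)).not_ge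
  have hcol : ∀ i ∈ A, ∀ x < c i, snakeColumn n x = j → x ∈ V := fun i hi x hxc hxj =>
    Finset.mem_filter.2 ⟨hU i hi x hxc hxj, Or.inl hxj⟩
  have hVU : V ⊆ U := Finset.filter_subset _ _
  have hex : ∃ q, ∃ i ∈ A, Covers (2 / 3) (s i) (V.filter (· < q)) (κ i) := by
    have hV : V.filter (· < V.sup id + 1) = V :=
      Finset.filter_true_of_mem fun x hx => Nat.lt_succ_iff.2 (Finset.le_sup (f := id) hx)
    have hsmall : V.filter (c i₀ ≤ ·) = U.filter (c i₀ ≤ ·) := by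
      rw [Finset.filter_filter]
      exact Finset.filter_congr fun x _ => ⟨And.right, fun hx => ⟨Or.inr hx, hx⟩⟩
    refine ⟨V.sup id + 1, i₀, hi₀, hV.symm ▸
      covers_of_columnGap_le (hs i₀) (h01 i₀) hj (hcol i₀ hi₀) ?_⟩
    rw [hsmall]
    linarith [hgap i₀ hi₀]
  refine ⟨V.filter (· < Nat.find hex), (Finset.filter_subset _ _).trans hVU, Nat.find_spec hex,
    fun i hi x hx => hVcol i hi x (Finset.mem_filter.1 hx).1, fun i hi => ?_⟩
  rcases le_or_gt (Nat.find hex) (c i) with hle | hlt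
  · rw [Finset.filter_false_of_mem fun x hx =>
      ((Finset.mem_filter.1 hx).2.trans_le hle).not_ge, Finset.sum_empty]
    exact columnGap_nonneg fun x => (h01 i x).2
  obtain ⟨p, hp⟩ := Nat.exists_eq_succ_of_ne_zero (Nat.ne_zero_of_lt hlt)
  have hcp : c i ≤ p := by omega
  have hnot : ¬ Covers (2 / 3) (s i) (V.filter (· < p)) (κ i) := fun hcov =>
    Nat.find_min hex (hp ▸ p.lt_succ_self) ⟨i, hi, hcov⟩
  have hlast : V.filter (· < Nat.find hex) ⊆ insert p (V.filter (· < p)) := fun x hx => by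
    simp only [Finset.mem_insert, Finset.mem_filter] at hx ⊢
    exact (show x ≤ p by omega).eq_or_lt.imp_right (And.intro hx.1)
  calc ∑ x ∈ V.filter (· < Nat.find hex) with c i ≤ x, s i x
      ≤ ∑ x ∈ insert p (V.filter (· < p)) with c i ≤ x, s i x :=
        Finset.sum_le_sum_of_subset_of_nonneg (Finset.filter_subset_filter _ hlast)
          fun x _ _ => (h01 i x).1
    _ ≤ columnGap (s i) n (κ i) j := sum_insert_le_columnGap (hs i) (h01 i) hj
        (fun x hxc hxj => Finset.mem_filter.2 ⟨hcol i hi x hxc hxj, hxc.trans_le hcp⟩) hnot hcp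

end BagFilling

section BagAssignment

variable {ι : Type*} {s : ι → ℕ → ℝ} {n : ℕ} {κ : ι → ℕ}

theorem exists_pairwiseDisjoint_of_erase {α : Type*} [DecidableEq ι] [DecidableEq α]
    {P : ι → Finset α → Prop}
    {A : Finset ι} {i : ι} (hi : i ∈ A) {F U : Finset α} (hFU : F ⊆ U) (hF : P i F)
    (h : ∃ B : ι → Finset α, (A.erase i : Set ι).PairwiseDisjoint B ∧
      ∀ l ∈ A.erase i, B l ⊆ U \ F ∧ P l (B l)) :
    ∃ B : ι → Finset α, (A : Set ι).PairwiseDisjoint B ∧ ∀ l ∈ A, B l ⊆ U ∧ P l (B l) := by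
  obtain ⟨B, hdisj, hB⟩ := h
  have hupdate : ∀ l ∈ A.erase i, Function.update B i F l = B l := fun l hl =>
    Function.update_of_ne (Finset.ne_of_mem_erase hl) _ _
  rw [← Finset.insert_erase hi, Finset.coe_insert]
  simp only [Finset.forall_mem_insert]
  refine ⟨Function.update B i F, Set.pairwiseDisjoint_insert.2 ⟨fun l hl k hk hlk => ?_,
    fun l hl _ => ?_⟩, ?_, fun l hl => ?_⟩
  · simpa only [Function.onFun, hupdate l hl, hupdate k hk] using hdisj hl hk hlk
  · rw [Function.update_self, hupdate l hl]
    exact Finset.disjoint_sdiff.mono_right (hB l hl).1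
  · rw [Function.update_self]
    exact ⟨hFU, hF⟩
  · rw [hupdate l hl]
    exact ⟨(hB l hl).1.trans Finset.sdiff_subset, (hB l hl).2⟩

theorem exists_disjoint_covers (hs : ∀ i, Antitone (s i)) (h01 : ∀ i x, s i x ∈ Set.Icc (0 : ℝ) 1)
    {C : Finset ℕ} (hC : ∀ j ∈ C, j < n) {A : Finset ι} (hcard : A.card = C.card) {U : Finset ℕ}
    (hU : ∀ i ∈ A, ∀ x < largeCount (s i) (n * κ i), snakeColumn n x ∈ C → x ∈ U)
    (hgap : ∀ i ∈ A, ∑ j ∈ C, columnGap (s i) n (κ i) j ≤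
      ∑ x ∈ U with largeCount (s i) (n * κ i) ≤ x, s i x) :
    ∃ B : ι → Finset ℕ, (A : Set ι).PairwiseDisjoint B ∧
      ∀ i ∈ A, B i ⊆ U ∧ Covers (2 / 3) (s i) (B i) (κ i) := by
  classical
  induction C using Finset.induction_on generalizing A U with
  | empty =>
    rw [Finset.card_empty, Finset.card_eq_zero] at hcard
    exact ⟨fun _ => ∅, by simp [hcard]⟩
  | insert j C hjC ih =>
    rw [Finset.card_insert_of_notMem hjC] at hcard
    simp only [Finset.sum_insert hjC] at hgap
    obtain ⟨hj, hC⟩ := Finset.forall_mem_insert .. |>.1 hC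
    have hnonneg : ∀ i, 0 ≤ ∑ j ∈ C, columnGap (s i) n (κ i) j := fun i =>
      Finset.sum_nonneg fun _ _ => columnGap_nonneg fun x => (h01 i x).2
    obtain ⟨F, hFU, ⟨i, hi, hcov⟩, hlarge, hsmall⟩ := exists_bag hs h01
      (Finset.card_pos.1 (hcard ▸ Nat.succ_pos _)) hj
      (fun i hi x hx hxj => hU i hi x hx (hxj ▸ Finset.mem_insert_self _ _))
      (fun i hi => (le_add_of_nonneg_right (hnonneg i)).trans (hgap i hi))
    refine exists_pairwiseDisjoint_of_erase (P := fun l B => Covers (2 / 3) (s l) B (κ l)) hi hFU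
      hcov (ih hC ?_ (fun l hl x hx hxC => ?_) fun l hl => ?_)
    · rw [Finset.card_erase_of_mem hi, hcard, Nat.add_sub_cancel]
    · have hlA := Finset.mem_of_mem_erase hl
      exact Finset.mem_sdiff.2 ⟨hU l hlA x hx (Finset.mem_insert_of_mem hxC),
        fun hxF => hjC (hlarge l hlA x hxF hx ▸ hxC)⟩
    · have hlA := Finset.mem_of_mem_erase hl
      have hsplit := Finset.sum_sdiff (f := fun x =>
        if largeCount (s l) (n * κ l) ≤ x then s l x else 0) hFU
      simp only [← Finset.sum_filter] at hsplit
      linarith [hgap l hlA, hsmall l hlA]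

end BagAssignment

theorem exists_forall_mem_eq {α ι : Type*} [Nonempty ι] {B : ι → Finset α}
    (hB : Pairwise fun i j => Disjoint (B i) (B j)) : ∃ o : α → ι, ∀ i, ∀ x ∈ B i, o x = i := by
  classical
  refine ⟨fun x => Classical.epsilon fun i => x ∈ B i, fun i x hx => ?_⟩
  by_contra hne
  exact Finset.disjoint_left.1 (hB hne)
    (Classical.epsilon_spec (p := fun i => x ∈ B i) ⟨i, hx⟩) hx

-- Hall's condition: for a set of positions with maximum `p`, already the first items in the order
-- of the owner of `p` provide enough choices.
theorem exists_perm_le {ι α β : Type*} [Finite α] [LinearOrder α] [Preorder β] {w : ι → α → β}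
    {σ : ι → Equiv.Perm α} (hσ : ∀ i, Antitone (w i ∘ σ i)) (o : α → ι) :
    ∃ g : Equiv.Perm α, ∀ p, w (o p) (σ (o p) p) ≤ w (o p) (g p) := by
  classical
  have := Fintype.ofFinite α
  obtain ⟨g, hg, hle⟩ := (Finset.all_card_le_biUnion_card_iff_exists_injective fun p : α =>
    Finset.univ.filter fun e => w (o p) (σ (o p) p) ≤ w (o p) e).1 fun T => by
      rcases T.eq_empty_or_nonempty with rfl | hT
      · exact Nat.zero_le _
      set p := T.max' hT
      calc T.card = (T.map (σ (o p)).toEmbedding).card := (Finset.card_map _).symm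
        _ ≤ _ := Finset.card_le_card fun e he => by
            obtain ⟨x, hx, rfl⟩ := Finset.mem_map.1 he
            exact Finset.mem_biUnion.2 ⟨p, T.max'_mem hT,
              Finset.mem_filter.2 ⟨Finset.mem_univ _, hσ (o p) (T.le_max' x hx)⟩⟩
  exact ⟨Equiv.ofBijective g (Finite.injective_iff_bijective.1 hg),
    fun p => (Finset.mem_filter.1 (hle p)).2⟩

theorem isKPartition_filter_eq {m k : ℕ} (f : Fin m → Fin k) (S : Finset (Fin m)) :
    IsKPartition (fun j => S.filter (f · = j)) S := by
  refine ⟨Finset.ext fun e => by simp, fun j l hjl => Finset.disjoint_filter.2 fun e _ hj hl => ?_⟩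
  exact hjl (hj.symm.trans hl)

namespace BinCoveringInstance

variable {n m : ℕ} (I : BinCoveringInstance n m) {i : Fin n}

theorem canSplit_of_covers {θ : ℝ} {S : Finset (Fin m)} {k : ℕ} (h : Covers θ (I.size i) S k) :
    I.CanSplit i θ k S := by
  intro hk
  obtain ⟨f, hf⟩ := h
  refine ⟨_, isKPartition_filter_eq (fun e => if he : f e < k then ⟨f e, he⟩ else ⟨0, hk⟩) S,
    fun j => (hf j j.2).trans (Finset.sum_le_sum_of_subset_of_nonneg (fun e he => ?_)
      fun e _ _ => (I.size_pos i e).le)⟩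
  obtain ⟨heS, hej⟩ := Finset.mem_filter.1 he
  exact Finset.mem_filter.2 ⟨heS, by simp [hej]⟩

theorem exists_unit_bins (i : Fin n) : ∃ Q : Fin n × Fin (I.mms i) → Finset (Fin m),
    (Pairwise fun x y => Disjoint (Q x) (Q y)) ∧ ∀ x, 1 ≤ I.bundleSize i (Q x) := by
  obtain ⟨X, ⟨-, hXd⟩, hX⟩ := (I.isGreatest_mms i).1
  have hle : ∀ j, I.mms i ≤ I.value i (X j) := fun j =>
    hX.trans_le (ciInf_le (OrderBot.bddBelow _) j)
  rcases Nat.eq_zero_or_pos (I.mms i) with h0 | hpos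
  · have : IsEmpty (Fin n × Fin (I.mms i)) := by rw [h0]; infer_instance
    exact ⟨fun _ => ∅, isEmptyElim, isEmptyElim⟩
  choose P hP hPs using fun j => (I.isGreatest_value i (X j)).1 (hpos.trans_le (hle j))
  have hPX : ∀ j a, P j a ⊆ X j := fun j a =>
    (hP j).1 ▸ Finset.subset_biUnion_of_mem (P j) (Finset.mem_univ a)
  refine ⟨fun x => P x.1 (Fin.castLE (hle x.1) x.2), ?_, fun x => hPs _ _⟩
  rintro ⟨j, a⟩ ⟨l, b⟩ hne
  rcases eq_or_ne j l with rfl | hjl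
  · exact (hP j).2 fun hab => hne (congrArg (Prod.mk j) (Fin.castLE_injective _ hab))
  · exact (hXd hjl).mono (hPX j _) (hPX l _)

/-- A permutation listing the items from the largest to the smallest one for agent `i`. -/
noncomputable def sortPerm (i : Fin n) : Equiv.Perm (Fin m) := Tuple.sort fun e => -I.size i e

/-- The sizes of the items for agent `i` in non-increasing order, followed by zeros. -/
noncomputable def sortedSize (i : Fin n) (x : ℕ) : ℝ :=
  if h : x < m then I.size i (I.sortPerm i ⟨x, h⟩) else 0

theorem antitone_size_sortPerm : Antitone (I.size i ∘ I.sortPerm i) := fun _ _ hxy =>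
  neg_le_neg_iff.1 (Tuple.monotone_sort (fun e => -I.size i e) hxy)

theorem sortedSize_val (x : Fin m) : I.sortedSize i x = I.size i (I.sortPerm i x) :=
  dif_pos x.2

theorem sortedSize_mem_Icc (x : ℕ) : I.sortedSize i x ∈ Set.Icc (0 : ℝ) 1 := by
  unfold sortedSize
  split_ifs
  · exact ⟨(I.size_pos _ _).le, I.size_le_one _ _⟩
  · exact ⟨le_rfl, zero_le_one⟩

theorem antitone_sortedSize : Antitone (I.sortedSize i) := fun x y hxy => by
  by_cases hy : y < m
  · rw [sortedSize, sortedSize, dif_pos hy, dif_pos (hxy.trans_lt hy)]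
    exact I.antitone_size_sortPerm (Fin.mk_le_mk.2 hxy)
  · rw [sortedSize, dif_neg hy]
    exact (I.sortedSize_mem_Icc x).1

theorem lt_of_lt_largeCount {N x : ℕ} (hx : x < largeCount (I.sortedSize i) N) : x < m := by
  have hlarge := ((lt_largeCount_iff I.antitone_sortedSize).1 hx).2
  by_contra hge
  rw [sortedSize, dif_neg hge] at hlarge
  norm_num at hlarge

theorem sum_gap_sortedSize_le :
    ∑ x ∈ Finset.range (headCount (I.sortedSize i) (n * I.mms i)),
        gap (I.sortedSize i) (n * I.mms i) x ≤
      ∑ x ∈ Finset.range m with largeCount (I.sortedSize i) (n * I.mms i) ≤ x,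
        I.sortedSize i x := by
  obtain ⟨Q, hQd, hQ⟩ := I.exists_unit_bins i
  have := sum_gap_le_of_bins (I.antitone_sortedSize (i := i)) I.sortedSize_mem_Icc
    (U := Finset.range m)
    (Q := fun x => (Q x).map ((I.sortPerm i).symm.toEmbedding.trans Fin.valEmbedding))
    (fun x y hxy => (Finset.disjoint_map _).2 (hQd hxy))
    (fun x y hy => by
      obtain ⟨e, -, rfl⟩ := Finset.mem_map.1 hy
      exact Finset.mem_range.2 ((I.sortPerm i).symm e).2)
    (fun x => by
      rw [Finset.sum_map]
      refine (hQ x).trans_eq (Finset.sum_congr rfl fun e _ => ?_)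
      simp [sortedSize_val])
  simpa only [Fintype.card_prod, Fintype.card_fin] using this

theorem exists_isKPartition_canSplit [NeZero n] {θ : ℝ} {κ : Fin n → ℕ} {B : Fin n → Finset ℕ}
    (hB : Pairwise fun i j => Disjoint (B i) (B j)) (hBm : ∀ i, B i ⊆ Finset.range m)
    (hcov : ∀ i, Covers θ (I.sortedSize i) (B i) (κ i)) :
    ∃ A : Fin n → Finset (Fin m), IsKPartition A Finset.univ ∧
      ∀ i, I.CanSplit i θ (κ i) (A i) := by
  obtain ⟨o, ho⟩ := exists_forall_mem_eq hB
  obtain ⟨g, hg⟩ := exists_perm_le (fun i => I.antitone_size_sortPerm (i := i)) fun p : Fin m => o p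
  refine ⟨_, isKPartition_filter_eq (fun e => o (g.symm e)) _, fun i => I.canSplit_of_covers <|
    (hcov i).comap (fun e => (I.size_pos i e).le) (fun e => (g.symm e : ℕ)) fun x hx => ?_⟩
  obtain ⟨p, rfl⟩ : ∃ p : Fin m, (p : ℕ) = x := ⟨⟨x, Finset.mem_range.1 (hBm i hx)⟩, rfl⟩
  have hop : o p = i := ho i p hx
  calc I.sortedSize i p = I.size i (I.sortPerm i p) := I.sortedSize_val p
    _ ≤ I.size i (g p) := by simpa only [hop] using hg p
    _ ≤ _ := Finset.single_le_sum (fun e _ => (I.size_pos i e).le) (by simp [hop])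

end BinCoveringInstance

theorem mainTheorem1 {n m : ℕ} (hn : 0 < n) (I : BinCoveringInstance n m) :
    ∃ A : Fin n → Finset (Fin m), I.IsCMMSAllocation (2 / 3) A := by
  have : NeZero n := ⟨hn.ne'⟩
  obtain ⟨B, hdisj, hB⟩ := exists_disjoint_covers (fun _ => I.antitone_sortedSize)
    (fun _ => I.sortedSize_mem_Icc) (C := Finset.range n) (fun j => Finset.mem_range.1)
    (A := Finset.univ) (by simp) (U := Finset.range m) (κ := I.mms)
    (fun i _ x hx _ => Finset.mem_range.2 (I.lt_of_lt_largeCount hx))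
    (fun i _ => (sum_columnGap hn).trans_le I.sum_gap_sortedSize_le)
  simp only [Finset.coe_univ, Finset.mem_univ, forall_const, forall_and] at hdisj hB
  exact I.exists_isKPartition_canSplit (Set.pairwise_univ.1 hdisj) hB.1 hB.2
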